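/- Let $k$ be an algebraically closed field of characteristic zero, $R=k[x_1,\dots,x_n]$, $d\ge 0$, and let $F\in k[x_0,\dots,x_n]$ be homogeneous of degree $d$ such that $\{x_0,\dots,x_n\}$ is a set of essential variables of $F$; that is, $n+1$ is the least $m$ for which there are linear forms $y_1,\dots,y_m\in k[x_0,\dots,x_n]$ with $F\in k[y_1,\dots,y_m]$. Put $f(x_1,\dots,x_n)=F(1,x_1,\dots,x_n)$ and let $f^*$ be the linear functional on $R_{\le d}=\{g\in R:\deg g\le d\}$ given by $$f^*(g)=\sum_{|\alpha|\le d}\frac{f_\alpha g_\alpha}{\binom d\alpha},\qquad \binom d\alpha=\frac{d!}{\alpha!\,(d-|\alpha|)!},$$ where $f_\alpha,g_\alpha$ are the coefficients of $x^\alpha$ in $f,g$. Let $\Lambda\in R^*=\operatorname{Hom}_k(R,k)$ extend $f^*$, i.e. $\Lambda(g)=f^*(g)$ for all $g\in R_{\le d}$. Let $I_\Lambda=\{p\in R:\Lambda(pq)=0\text{ for all }q\in R\}$ and $A_\Lambda=R/I_\Lambda$. Then there is a set $B$ of monomials of $R$ whose classes form a $k$-basis of $A_\Lambda$ and which is a complete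 staircase: it is closed under division ($x^\alpha x_i\in B$ implies $x^\alpha\in B$) and contains $1$ and $x_1,\dots,x_n$. If moreover $\Lambda$ comes from a Waring decomposition of $f$, i.e. $\Lambda=\sum_{i=1}^r\lambda_i\mathbb 1_{\zeta_i}$ with $\lambda_i\in k$ and $\mathbb 1_{\zeta_i}$ the evaluation at $\zeta_i\in k^n$, where $r$ is the least number of terms of any such linear combination of evaluations that extends $f^*$, then $B$ can be chosen so that, in addition, all its elements have degree at most $d$. -/

import Mathlib

open MvPolynomial

noncomputable section

namespace WaringStaircase

variable {k : Type*} [Field k] {n d : ℕ}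

/-- The space of degree-`d` forms in the `n + 1` variables `x_0, …, x_n`. -/
abbrev Form (k : Type*) [Field k] (n d : ℕ) : Submodule k (MvPolynomial (Fin (n + 1)) k) :=
  homogeneousSubmodule (Fin (n + 1)) k d

/-- The space of polynomials of total degree at most `d` in the `n` variables `x_1, …, x_n`
(the variable `x_{i+1}` is `X i` for `i : Fin n`). -/
abbrev PolyLE (k : Type*) [Field k] (n d : ℕ) : Submodule k (MvPolynomial (Fin n) k) :=
  restrictTotalDegree (Fin n) k d

/-- The substitution `F(x_0, x_1, …, x_n) ↦ F(1, x_1, …, x_n)`. -/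
def dehomogenizeAlgHom (k : Type*) [Field k] (n : ℕ) :
    MvPolynomial (Fin (n + 1)) k →ₐ[k] MvPolynomial (Fin n) k :=
  aeval (Fin.cons 1 X)

theorem dehomogenizeAlgHom_mem (F : Form k n d) :
    dehomogenizeAlgHom k n (F : MvPolynomial (Fin (n + 1)) k) ∈ PolyLE k n d := by
  have hF := (mem_homogeneousSubmodule d (F : MvPolynomial (Fin (n + 1)) k)).1 F.2
  rw [mem_restrictTotalDegree, dehomogenizeAlgHom, aeval_def, eval₂_eq']
  refine totalDegree_finsetSum_le fun m hm => ?_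
  have hdeg : ∑ i, m i = d := by
    have h := hF (mem_support_iff.1 hm)
    rwa [Pi.one_def, ← Finsupp.degree_eq_weight_one, Finsupp.degree_eq_sum] at h
  refine (totalDegree_mul _ _).trans ?_
  rw [algebraMap_eq, totalDegree_C, zero_add, ← hdeg]
  refine (totalDegree_finsetProd _ _).trans (Finset.sum_le_sum fun i _ => ?_)
  refine (totalDegree_pow _ _).trans ?_
  refine Fin.cases ?_ (fun j => ?_) i
  · simp
  · simp

/-- The dehomogenization `f(x_1, …, x_n) = F(1, x_1, …, x_n)` of a degree-`d` form. -/
def dehomogenize (F : Form k n d) : PolyLE k n d :=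
  ⟨dehomogenizeAlgHom k n F, dehomogenizeAlgHom_mem F⟩

/-- The multinomial coefficient `d! / (α! (d - |α|)!)`, as an element of `k`
(meaningful for `|α| ≤ d`, the only case in which it is used). -/
def multinom (k : Type*) [Field k] {n : ℕ} (d : ℕ) (α : Fin n →₀ ℕ) : k :=
  (d.factorial : k) / ((∏ i, ((α i).factorial : k)) * ((d - α.degree).factorial : k))

/-- The apolar product `∑_{|α| ≤ d} f_α g_α / (d choose α)` on polynomials of degree at most `d`;
the terms with `f_α = 0` are left out of the sum. -/
def apolarProduct (f g : PolyLE k n d) : k :=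
  ∑ α ∈ (f : MvPolynomial (Fin n) k).support,
    coeff α (f : MvPolynomial (Fin n) k) * coeff α (g : MvPolynomial (Fin n) k) / multinom k d α

/-- The dual polynomial `f* = (g ↦ ⟨f, g⟩)` in the dual of the polynomials of degree at most `d`. -/
def dualPolynomial (f : PolyLE k n d) : Module.Dual k (PolyLE k n d) where
  toFun g := apolarProduct f g
  map_add' g h := by
    simp only [apolarProduct, ← Finset.sum_add_distrib]
    exact Finset.sum_congr rfl fun α _ => by simp; ring
  map_smul' c g := by
    simp only [apolarProduct, RingHom.id_apply, smul_eq_mul, Finset.mul_sum]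
    exact Finset.sum_congr rfl fun α _ => by simp; ring

/-- `Λ`, a linear functional on all polynomials, extends a functional `φ` given on those of degree
at most `d`. -/
def Extends (Λ : Module.Dual k (MvPolynomial (Fin n) k)) (φ : Module.Dual k (PolyLE k n d)) :
    Prop :=
  ∀ g : PolyLE k n d, Λ (g : MvPolynomial (Fin n) k) = φ g

/-- The functional `∑ i, c i • 1_{ζ i}`, where `1_ζ` is the evaluation at the point `ζ`. -/
def evalSum {r : ℕ} (c : Fin r → k) (ζ : Fin r → Fin n → k) :
    Module.Dual k (MvPolynomial (Fin n) k) :=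
  ∑ i, c i • (aeval (ζ i) : MvPolynomial (Fin n) k →ₐ[k] k).toLinearMap

/-- `Λ` is a linear combination of evaluations at points, with as few terms as any linear
combination of evaluations at points that extends `φ`. -/
def IsMinimalEvalSum (Λ : Module.Dual k (MvPolynomial (Fin n) k))
    (φ : Module.Dual k (PolyLE k n d)) : Prop :=
  ∃ (r : ℕ) (c : Fin r → k) (ζ : Fin r → Fin n → k), Λ = evalSum c ζ ∧
    ∀ (s : ℕ) (b : Fin s → k) (ξ : Fin s → Fin n → k), Extends (evalSum b ξ) φ → r ≤ s

/-- The Hankel operator `f ↦ f ⋆ Λ = (g ↦ Λ (f g))`. -/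
def hankel (Λ : Module.Dual k (MvPolynomial (Fin n) k)) :
    MvPolynomial (Fin n) k →ₗ[k] Module.Dual k (MvPolynomial (Fin n) k) where
  toFun f := Λ ∘ₗ LinearMap.mulLeft k f
  map_add' f g := LinearMap.ext fun h => by simp [add_mul]
  map_smul' c f := LinearMap.ext fun h => by simp

/-- The kernel `I_Λ` of the Hankel operator, as an ideal. -/
def hankelIdeal (Λ : Module.Dual k (MvPolynomial (Fin n) k)) : Ideal (MvPolynomial (Fin n) k) where
  carrier := {f | hankel Λ f = 0}
  add_mem' {f g} hf hg := by
    simp only [Set.mem_ofPred_eq] at hf hg ⊢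
    rw [map_add, hf, hg, add_zero]
  zero_mem' := map_zero _
  smul_mem' a f hf := by
    refine LinearMap.ext fun g => ?_
    have h := LinearMap.congr_fun (show hankel Λ f = 0 from hf) (a * g)
    simpa [hankel, mul_assoc, mul_left_comm] using h

/-- The quotient algebra `A_Λ` of the polynomial ring by `I_Λ`. -/
abbrev HankelAlgebra (Λ : Module.Dual k (MvPolynomial (Fin n) k)) : Type _ :=
  MvPolynomial (Fin n) k ⧸ hankelIdeal Λ

/-- The classes of the monomials with exponents in `B` form a `k`-basis of `A_Λ`
(distinct exponents giving distinct basis elements). -/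
def IsMonomialBasis (Λ : Module.Dual k (MvPolynomial (Fin n) k)) (B : Set (Fin n →₀ ℕ)) : Prop :=
  LinearIndependent k
      (fun α : B => (Ideal.Quotient.mk (hankelIdeal Λ) (monomial (α : Fin n →₀ ℕ) (1 : k)) :
        HankelAlgebra Λ)) ∧
    Submodule.span k
      (Set.range fun α : B =>
        (Ideal.Quotient.mk (hankelIdeal Λ) (monomial (α : Fin n →₀ ℕ) (1 : k)) :
          HankelAlgebra Λ)) = ⊤

/-- A set of monomials, given by their exponents, is a staircase. -/
def IsStaircase (B : Set (Fin n →₀ ℕ)) : Prop :=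
  ∀ (α : Fin n →₀ ℕ) (i : Fin n), α + Finsupp.single i 1 ∈ B → α ∈ B

/-- A staircase is complete if it contains all the degree-one monomials. -/
def IsCompleteStaircase (B : Set (Fin n →₀ ℕ)) : Prop :=
  IsStaircase B ∧ ∀ i : Fin n, Finsupp.single i 1 ∈ B

/-- `F` is a polynomial in the linear forms `y_1, …, y_m`. -/
def IsPolynomialIn (F : MvPolynomial (Fin (n + 1)) k) {m : ℕ}
    (y : Fin m → MvPolynomial (Fin (n + 1)) k) : Prop :=
  (∀ i, (y i).IsHomogeneous 1) ∧ F ∈ Algebra.adjoin k (Set.range y)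

/-- The essential number of variables of `F`. -/
def essNumber (F : MvPolynomial (Fin (n + 1)) k) : ℕ :=
  sInf {m | ∃ y : Fin m → MvPolynomial (Fin (n + 1)) k, IsPolynomialIn F y}

/-- `y_1, …, y_m` is a set of essential variables of `F`. -/
def IsEssentialVariables (F : MvPolynomial (Fin (n + 1)) k) {m : ℕ}
    (y : Fin m → MvPolynomial (Fin (n + 1)) k) : Prop :=
  IsPolynomialIn F y ∧ m = essNumber F

end WaringStaircase

end

/-! Take `B` to be the standard monomials of `I_Λ` for a graded order: division makes them a basis
of `A_Λ`, and multiplicativity of leading terms makes them a staircase. Completeness amounts to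
`I_Λ` having no nonzero element of degree at most one. If `p = a_0 + ∑ a_i x_i` lies in `I_Λ`, the
values `Λ(p x^β)` with `|β| < d` are, up to nonzero factors, the coefficients of the derivative of
`F` along `a`. So that derivative vanishes, and if `a ≠ 0` a linear change of variables writes `F`
in `n` linear forms, against essentiality. For the degree bound, minimality makes the evaluations at
the `ζ_i` independent on `R_{≤d}`, so every polynomial is congruent modulo `I_Λ` to one of degree at
most `d`; in a graded order no standard monomial can then exceed degree `d`. -/

namespace WaringStaircase

open scoped MonomialOrder

/-! ### Standard monomials of an ideal -/

section StandardMonomials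

variable {k : Type*} [Field k] {n : ℕ}

/-- The exponents that are not the leading exponent of a nonzero element of `I`, for the
degree-lexicographic order. -/
def standardExponents (I : Ideal (MvPolynomial (Fin n) k)) : Set (Fin n →₀ ℕ) :=
  {α | ∀ p ∈ I, p ≠ 0 → MonomialOrder.degLex.degree p ≠ α}

theorem add_single_notMem_standardExponents {I : Ideal (MvPolynomial (Fin n) k)}
    {α : Fin n →₀ ℕ} (hα : α ∉ standardExponents I) (β : Fin n →₀ ℕ) :
    α + β ∉ standardExponents I := by
  simp only [standardExponents, Set.mem_ofPred_eq, not_forall, not_not] at hα ⊢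
  obtain ⟨p, hp, hp0, rfl⟩ := hα
  have hβ : (monomial β (1 : k)) ≠ 0 := by simp
  refine ⟨p * monomial β 1, I.mul_mem_right _ hp, mul_ne_zero hp0 hβ, ?_⟩
  classical
  rw [MonomialOrder.degree_mul hp0 hβ, MonomialOrder.degree_monomial, if_neg one_ne_zero]

theorem isStaircase_standardExponents (I : Ideal (MvPolynomial (Fin n) k)) :
    IsStaircase (standardExponents I) := fun α i h => by
  by_contra hα
  exact add_single_notMem_standardExponents hα _ h

theorem eq_zero_of_mem_of_support_subset_standardExponents {I : Ideal (MvPolynomial (Fin n) k)}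
    {p : MvPolynomial (Fin n) k} (hp : p ∈ I) (hs : ↑p.support ⊆ standardExponents I) : p = 0 := by
  by_contra h0
  exact hs (MonomialOrder.degLex.degree_mem_support h0) p hp h0 rfl

/-- Divide by all nonzero elements of `I` at once; over a field their leading coefficients are
units, so no Gröbner basis has to be chosen. -/
theorem exists_sub_mem_of_standardExponents (I : Ideal (MvPolynomial (Fin n) k))
    (f : MvPolynomial (Fin n) k) :
    ∃ r : MvPolynomial (Fin n) k, f - r ∈ I ∧ ↑r.support ⊆ standardExponents I := by
  obtain ⟨g, r, hf, -, hr⟩ := MonomialOrder.degLex.div_set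
    (B := {p : MvPolynomial (Fin n) k | p ∈ I ∧ p ≠ 0})
    (fun b hb => (MonomialOrder.leadingCoeff_ne_zero_iff.2 hb.2).isUnit) f
  refine ⟨r, ?_, fun c hc p hp hp0 hpc => hr c hc p ⟨hp, hp0⟩ hpc.le⟩
  rw [hf, add_sub_cancel_right, Finsupp.linearCombination_apply]
  exact I.sum_mem fun b _ => I.mul_mem_left _ b.2.1

theorem isMonomialBasis_standardExponents (Λ : Module.Dual k (MvPolynomial (Fin n) k)) :
    IsMonomialBasis Λ (standardExponents (hankelIdeal Λ)) := by
  set I := hankelIdeal Λ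
  constructor
  · rw [linearIndependent_iff]
    intro l hl
    let p : MvPolynomial (Fin n) k :=
      Finsupp.linearCombination k (fun α : standardExponents I => monomial (α : Fin n →₀ ℕ) 1) l
    have hp : p ∈ I := by
      rw [← Ideal.Quotient.eq_zero_iff_mem, ← hl]
      exact Finsupp.apply_linearCombination k (Ideal.Quotient.mkₐ k I).toLinearMap _ l
    have hcoeff : ∀ β, coeff β p = l.sum fun α c => if (α : Fin n →₀ ℕ) = β then c else 0 := by
      intro β
      simp only [p, Finsupp.linearCombination_apply, Finsupp.sum, coeff_sum, coeff_smul,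
        coeff_monomial, smul_eq_mul, mul_ite, mul_one, mul_zero]
    have hp0 : p = 0 := by
      refine eq_zero_of_mem_of_support_subset_standardExponents hp fun β hβ => ?_
      by_contra hB
      refine mem_support_iff.1 hβ ((hcoeff β).trans (Finset.sum_eq_zero fun α _ => if_neg ?_))
      rintro rfl
      exact hB α.2
    ext α
    have h := hcoeff α
    rw [hp0, coeff_zero] at h
    simpa [Subtype.coe_inj, Finsupp.sum, Finset.sum_ite_eq', eq_comm] using h.symm
  · rw [eq_top_iff]
    rintro x -
    obtain ⟨f, rfl⟩ := Ideal.Quotient.mk_surjective x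
    obtain ⟨r, hr, hs⟩ := exists_sub_mem_of_standardExponents I f
    rw [Ideal.Quotient.eq.2 hr, r.as_sum, map_sum]
    refine Submodule.sum_mem _ fun α hα => ?_
    have : (monomial α (coeff α r) : MvPolynomial (Fin n) k) = coeff α r • monomial α 1 := by
      rw [smul_monomial, smul_eq_mul, mul_one]
    rw [this]
    rw [← Ideal.Quotient.mkₐ_eq_mk k, map_smul]
    exact Submodule.smul_mem _ (coeff α r)
      (Submodule.subset_span (Set.mem_range_self (⟨α, hs hα⟩ : standardExponents I)))

theorem mem_standardExponents_of_degree_le {I : Ideal (MvPolynomial (Fin n) k)} {e : ℕ}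
    (hI : ∀ p ∈ I, p.totalDegree ≤ e → p = 0) {α : Fin n →₀ ℕ} (hα : α.degree ≤ e) :
    α ∈ standardExponents I := by
  rintro p hp hp0 rfl
  rw [MvPolynomial.degree_degLexDegree] at hα
  exact hp0 (hI p hp hα)

/-- If `|α| > d`, reducing `x^α` to some `q` of degree at most `d` gives `x^α - q` in `I`, whose
leading exponent is `α` because the order compares degrees first. -/
theorem degree_le_of_mem_standardExponents {I : Ideal (MvPolynomial (Fin n) k)} {d : ℕ}
    (hI : ∀ p, ∃ q ∈ PolyLE k n d, p - q ∈ I) {α : Fin n →₀ ℕ}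
    (hα : α ∈ standardExponents I) : α.degree ≤ d := by
  by_contra! hd
  obtain ⟨q, hq, hqI⟩ := hI (monomial α 1)
  rw [mem_restrictTotalDegree] at hq
  classical
  have hdeg : MonomialOrder.degLex.degree (monomial α (1 : k)) = α := by
    rw [MonomialOrder.degree_monomial, if_neg one_ne_zero]
  have hlt : MonomialOrder.degLex.degree (-q) ≺[MonomialOrder.degLex]
      MonomialOrder.degLex.degree (monomial α (1 : k)) := by
    rw [MonomialOrder.degLex_lt_iff, Finsupp.DegLex.lt_iff]
    left
    simp only [ofDegLex_toDegLex, MvPolynomial.degree_degLexDegree, totalDegree_neg]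
    rw [totalDegree_monomial _ one_ne_zero]
    exact hq.trans_lt hd
  have h := MonomialOrder.degree_add_of_lt hlt
  rw [← sub_eq_add_neg, hdeg] at h
  refine hα _ hqI (fun h0 => ?_) h
  rw [h0, MonomialOrder.degree_zero] at h
  simp [← h] at hd

end StandardMonomials

/-! ### Linear elements of `I_Λ` and directional derivatives of `F` -/

section Derivative

variable {k : Type*} [Field k] {n d : ℕ}

theorem degree_eq_of_coeff_ne_zero (F : Form k n d) {m : Fin (n + 1) →₀ ℕ}
    (hm : coeff m (F : MvPolynomial (Fin (n + 1)) k) ≠ 0) : m.degree = d := by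
  have h := (mem_homogeneousSubmodule d (F : MvPolynomial (Fin (n + 1)) k)).1 F.2 hm
  rwa [Pi.one_def, ← Finsupp.degree_eq_weight_one] at h

theorem degree_eq_add_degree_tail (m : Fin (n + 1) →₀ ℕ) : m.degree = m 0 + m.tail.degree := by
  simp [Finsupp.degree_eq_sum, Fin.sum_univ_succ, Finsupp.tail_apply]

theorem dehomogenizeAlgHom_monomial (m : Fin (n + 1) →₀ ℕ) (c : k) :
    dehomogenizeAlgHom k n (monomial m c) = monomial m.tail c := by
  rw [dehomogenizeAlgHom, aeval_monomial, monomial_eq, Finsupp.prod_fintype _ _ (by simp),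
    Finsupp.prod_fintype _ _ (by simp), Fin.prod_univ_succ]
  simp [Finsupp.tail_apply]

theorem coeff_tail_dehomogenize (F : Form k n d) {m : Fin (n + 1) →₀ ℕ} (hm : m.degree = d) :
    coeff m.tail (dehomogenize F : MvPolynomial (Fin n) k) =
      coeff m (F : MvPolynomial (Fin (n + 1)) k) := by
  classical
  change coeff m.tail (dehomogenizeAlgHom k n F) = _
  conv_lhs => rw [(F : MvPolynomial (Fin (n + 1)) k).as_sum]
  simp only [map_sum, coeff_sum, dehomogenizeAlgHom_monomial, coeff_monomial]
  rw [Finset.sum_eq_single m, if_pos rfl]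
  · intro b hb hbm
    refine if_neg fun ht => hbm ?_
    have hbd := degree_eq_of_coeff_ne_zero F (mem_support_iff.1 hb)
    rw [degree_eq_add_degree_tail, ht] at hbd
    rw [degree_eq_add_degree_tail] at hm
    -- In fixed total degree the tail determines the exponent of `x_0`.
    rw [← Finsupp.cons_tail b, ← Finsupp.cons_tail m, ht]
    congr 1
    omega
  · intro h
    simpa using h

theorem multinom_tail {m : Fin (n + 1) →₀ ℕ} (hm : m.degree = d) :
    multinom k d m.tail = (d.factorial : k) / ∏ i, ((m i).factorial : k) := by
  have h0 : d - m.tail.degree = m 0 := by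
    rw [degree_eq_add_degree_tail] at hm
    omega
  rw [multinom, h0, Fin.prod_univ_succ, mul_comm]
  rfl

theorem apply_monomial_tail (F : Form k n d) {Λ : Module.Dual k (MvPolynomial (Fin n) k)}
    (hΛ : Extends Λ (dualPolynomial (dehomogenize F))) {m : Fin (n + 1) →₀ ℕ}
    (hm : m.degree = d) :
    Λ (monomial m.tail 1) = coeff m (F : MvPolynomial (Fin (n + 1)) k) *
      (∏ i, ((m i).factorial : k)) / (d.factorial : k) := by
  classical
  have hmem : (monomial m.tail (1 : k)) ∈ PolyLE k n d := by
    rw [mem_restrictTotalDegree, totalDegree_monomial _ one_ne_zero]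
    change m.tail.degree ≤ d
    rw [← hm, degree_eq_add_degree_tail]
    omega
  have h := hΛ ⟨_, hmem⟩
  change Λ (monomial m.tail 1) = apolarProduct _ _ at h
  rw [h, apolarProduct, Finset.sum_eq_single m.tail]
  · rw [coeff_tail_dehomogenize F hm, multinom_tail hm]
    simp [div_div_eq_mul_div]
  · intro b _ hb
    simp [coeff_monomial, hb.symm]
  · intro hb
    simp [notMem_support_iff.1 hb]

/-- The derivative of `F` in the direction `a`. -/
noncomputable def directionalDeriv (a : Fin (n + 1) → k) :
    Derivation k (MvPolynomial (Fin (n + 1)) k) (MvPolynomial (Fin (n + 1)) k) :=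
  ∑ i, a i • pderiv i

theorem directionalDeriv_apply (a : Fin (n + 1) → k) (p : MvPolynomial (Fin (n + 1)) k) :
    directionalDeriv a p = ∑ i, a i • pderiv i p := by
  have h := map_sum (Derivation.coeFnAddMonoidHom (R := k) (A := MvPolynomial (Fin (n + 1)) k)
    (M := MvPolynomial (Fin (n + 1)) k)) (fun i => a i • pderiv i) Finset.univ
  simp only [Derivation.coeFnAddMonoidHom, AddMonoidHom.coe_mk, ZeroHom.coe_mk] at h
  rw [directionalDeriv, h, Finset.sum_apply]
  rfl

theorem directionalDeriv_X (a : Fin (n + 1) → k) (i : Fin (n + 1)) :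
    directionalDeriv a (X i) = C (a i) := by
  classical
  rw [directionalDeriv_apply, Finset.sum_eq_single i]
  · simp [smul_eq_C_mul]
  · intro j _ hj
    rw [pderiv_X_of_ne hj.symm, smul_zero]
  · simp

theorem eq_of_totalDegree_le_one {p : MvPolynomial (Fin n) k} (hp : p.totalDegree ≤ 1) :
    p = monomial 0 (coeff 0 p) +
      ∑ i, monomial (Finsupp.single i 1) (coeff (Finsupp.single i 1) p) := by
  classical
  ext β
  simp only [coeff_add, coeff_sum, coeff_monomial]
  rcases Nat.lt_or_ge β.degree 2 with h2 | h2
  · rcases (show β.degree = 0 ∨ β.degree = 1 by omega) with h | h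
    · obtain rfl := (Finsupp.degree_eq_zero_iff _).1 h
      simp
    · obtain ⟨i, rfl⟩ := (Finsupp.sum_eq_one_iff β).1 h
      simp [Finsupp.single_left_inj, eq_comm (a := (0 : Fin n →₀ ℕ))]
  · have h0 : coeff β p = 0 := coeff_eq_zero_of_totalDegree_lt (by
      rw [← Finsupp.degree_apply]
      omega)
    rw [h0, if_neg, Finset.sum_eq_zero, add_zero]
    · intro i _
      refine if_neg ?_
      rintro rfl
      simp at h2
    · rintro rfl
      simp at h2

/-- Multiplying by `x_i` raises `m i` by one, and the extra factor `m i + 1` in the factorials is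
the one produced by `pderiv i`. The constant term of `p` plays the role of `x_0`. -/
theorem apply_mul_monomial_tail [CharZero k] (F : Form k n d)
    {Λ : Module.Dual k (MvPolynomial (Fin n) k)}
    (hΛ : Extends Λ (dualPolynomial (dehomogenize F))) {p : MvPolynomial (Fin n) k}
    (hp : p.totalDegree ≤ 1) {m : Fin (n + 1) →₀ ℕ} (hm : m.degree + 1 = d) :
    Λ (p * monomial m.tail 1) =
      coeff m (directionalDeriv (Fin.cons (coeff 0 p) fun i => coeff (Finsupp.single i 1) p)
        (F : MvPolynomial (Fin (n + 1)) k)) *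
      ((∏ i, ((m i).factorial : k)) / (d.factorial : k)) := by
  classical
  have hstep : ∀ i, Λ (monomial (m + Finsupp.single i 1).tail 1) =
      coeff m (pderiv i (F : MvPolynomial (Fin (n + 1)) k)) *
        ((∏ i, ((m i).factorial : k)) / (d.factorial : k)) := by
    intro i
    have hprod : ∏ j, (((m + Finsupp.single i 1 : Fin (n + 1) →₀ ℕ) j).factorial : k) =
        (m i + 1) * ∏ j, ((m j).factorial : k) := by
      rw [← Finset.mul_prod_erase _ _ (Finset.mem_univ i),
        ← Finset.mul_prod_erase _ (fun i => ((m i).factorial : k)) (Finset.mem_univ i), ← mul_assoc]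
      congr 1
      · simp [Nat.factorial_succ]
      · refine Finset.prod_congr rfl fun j hj => ?_
        simp [Finsupp.single_eq_of_ne (Finset.ne_of_mem_erase hj)]
    rw [apply_monomial_tail F hΛ (by simpa using hm), coeff_pderiv, hprod, mul_div_assoc,
      mul_div_assoc, mul_assoc]
  have h0 : (m + Finsupp.single 0 1).tail = m.tail := by
    ext j
    simp [Finsupp.tail_apply]
  have hs : ∀ i : Fin n, (m + Finsupp.single i.succ 1).tail = Finsupp.single i 1 + m.tail := by
    intro i
    ext j
    simp [Finsupp.single_apply, Finsupp.tail_apply, add_comm]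
  have hsmul : ∀ (β : Fin n →₀ ℕ) (c : k),
      Λ (monomial β c) = c * Λ (monomial β 1) := by
    intro β c
    rw [← smul_eq_mul, ← map_smul, smul_monomial, smul_eq_mul, mul_one]
  conv_lhs => rw [eq_of_totalDegree_le_one hp]
  rw [add_mul, Finset.sum_mul, map_add, map_sum, directionalDeriv_apply, coeff_sum,
    Fin.sum_univ_succ, add_mul, Finset.sum_mul]
  simp only [monomial_mul, mul_one, zero_add, Fin.cons_zero, Fin.cons_succ, coeff_smul,
    smul_eq_mul, mul_assoc]
  congr 1
  · rw [hsmul, ← hstep 0, h0]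
  · refine Finset.sum_congr rfl fun i _ => ?_
    rw [hsmul, ← hstep i.succ, hs]

theorem directionalDeriv_eq_zero [CharZero k] (F : Form k n d)
    {Λ : Module.Dual k (MvPolynomial (Fin n) k)}
    (hΛ : Extends Λ (dualPolynomial (dehomogenize F))) {p : MvPolynomial (Fin n) k}
    (hp : p.totalDegree ≤ 1) (hpI : p ∈ hankelIdeal Λ) :
    directionalDeriv (Fin.cons (coeff 0 p) fun i => coeff (Finsupp.single i 1) p)
      (F : MvPolynomial (Fin (n + 1)) k) = 0 := by
  ext m
  rw [coeff_zero]
  by_cases hm : m.degree + 1 = d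
  · have h := apply_mul_monomial_tail F hΛ hp hm
    have hz : Λ (p * monomial m.tail 1) = 0 :=
      LinearMap.congr_fun (show hankel Λ p = 0 from hpI) (monomial m.tail 1)
    rw [hz] at h
    refine (mul_eq_zero.1 h.symm).resolve_right (div_ne_zero ?_ ?_)
    · exact Finset.prod_ne_zero_iff.2 fun i _ => Nat.cast_ne_zero.2 (Nat.factorial_ne_zero _)
    · exact Nat.cast_ne_zero.2 (Nat.factorial_ne_zero _)
  -- Outside degree `d - 1` the coefficients vanish by homogeneity of `F`.
  · rw [directionalDeriv_apply, coeff_sum]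
    refine Finset.sum_eq_zero fun i _ => ?_
    have h0 : coeff (m + Finsupp.single i 1) (F : MvPolynomial (Fin (n + 1)) k) = 0 := by
      by_contra h
      exact hm (by simpa using degree_eq_of_coeff_ne_zero F h)
    rw [coeff_smul, coeff_pderiv, h0, zero_mul, smul_zero]

theorem mem_supported_compl_of_pderiv_eq_zero [CharZero k] {σ : Type*} {j : σ}
    {G : MvPolynomial σ k} (hG : pderiv j G = 0) : G ∈ supported k ({j}ᶜ : Set σ) := by
  classical
  rw [mem_supported]
  intro i hi
  rw [Set.mem_compl_singleton_iff]
  rintro rfl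
  obtain ⟨m, hm, hmi⟩ := mem_vars_iff_mem_support i |>.1 (Finset.mem_coe.1 hi)
  have hle : Finsupp.single i 1 ≤ m := by
    rw [Finsupp.single_le_iff]
    exact Nat.one_le_iff_ne_zero.2 (Finsupp.mem_support_iff.1 hmi)
  have h := coeff_pderiv (i := i) G (m - Finsupp.single i 1)
  rw [hG, coeff_zero, tsub_add_cancel_of_le hle] at h
  refine mul_ne_zero (mem_support_iff.1 hm) ?_ h.symm
  exact Nat.cast_add_one_ne_zero _

/-- A polynomial killed by the derivative in a nonzero direction is a polynomial in `n` linear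
forms. -/
theorem essNumber_le_of_directionalDeriv_eq_zero [CharZero k]
    {F : MvPolynomial (Fin (n + 1)) k} {a : Fin (n + 1) → k} (ha : a ≠ 0)
    (hF : directionalDeriv a F = 0) : essNumber F ≤ n := by
  classical
  obtain ⟨j, hj⟩ := Function.ne_iff.1 ha
  rw [Pi.zero_apply] at hj
  -- A linear substitution carrying the direction `e_j` to `a`, so that `pderiv j ∘ φ = φ ∘
  -- directionalDeriv a`; `ψ` undoes it.
  let φ : MvPolynomial (Fin (n + 1)) k →ₐ[k] MvPolynomial (Fin (n + 1)) k :=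
    aeval fun i => (if i = j then 0 else X i) + C (a i) * X j
  let ψ : MvPolynomial (Fin (n + 1)) k →ₐ[k] MvPolynomial (Fin (n + 1)) k :=
    aeval fun i => if i = j then C (a j)⁻¹ * X j else X i - C (a i * (a j)⁻¹) * X j
  have hψφ : ∀ p, ψ (φ p) = p := by
    suffices h : ψ.comp φ = AlgHom.id k _ from fun p => AlgHom.congr_fun h p
    refine algHom_ext fun i => ?_
    have hCj : (C (a j) * C (a j)⁻¹ : MvPolynomial (Fin (n + 1)) k) = 1 := by
      rw [← C_mul, mul_inv_cancel₀ hj, C_1]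
    have hψj : ψ (X j) = C (a j)⁻¹ * X j := by simp [ψ]
    have hψC : ∀ c, ψ (C c) = C c := fun c => ψ.commutes c
    by_cases hi : i = j
    · subst hi
      simp [φ, hψC, hψj, ← mul_assoc, hCj]
    · have hψi : ψ (X i) = X i - C (a i * (a j)⁻¹) * X j := by simp [ψ, hi]
      simp [φ, hi, hψC, hψj, hψi, mul_assoc]
  have hder : ∀ p, pderiv j (φ p) = φ (directionalDeriv a p) := by
    intro p
    induction p using MvPolynomial.induction_on with
    | C c =>
      rw [← algebraMap_eq, φ.commutes, Derivation.map_algebraMap, Derivation.map_algebraMap,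
        map_zero]
    | add p q hp hq => simp only [map_add, hp, hq]
    | mul_X p i hp =>
      have hX : pderiv j (φ (X i)) = C (a i) := by
        by_cases hi : i = j
        · simp [φ, hi]
        · simp [φ, hi, pderiv_X_of_ne hi]
      have hC : φ (C (a i)) = C (a i) := φ.commutes _
      rw [map_mul, Derivation.leibniz, Derivation.leibniz, hp, hX, directionalDeriv_X]
      simp only [map_add, smul_eq_mul, map_mul, hC]
  have hsupp : φ F ∈ supported k ({j}ᶜ : Set (Fin (n + 1))) :=
    mem_supported_compl_of_pderiv_eq_zero (by rw [hder, hF, map_zero])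
  -- Since `φ F` does not involve `x_j`, applying `ψ` writes `F` in the `n` forms `ψ x_i`, `i ≠ j`.
  refine Nat.sInf_le ⟨fun i => ψ (X (j.succAbove i)), fun i => ?_, ?_⟩
  · simp only [ψ, aeval_X, if_neg (Fin.succAbove_ne j i)]
    exact (isHomogeneous_X k _).sub (isHomogeneous_C_mul_X _ j)
  · have hrange : Set.range (fun i => ψ (X (j.succAbove i))) =
        ψ '' (X '' ({j}ᶜ : Set (Fin (n + 1)))) := by
      rw [← Fin.range_succAbove, ← Set.range_comp, ← Set.range_comp]
      rfl
    rw [hrange, ← AlgHom.map_adjoin]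
    rw [supported_eq_adjoin_X] at hsupp
    exact Subalgebra.mem_map.2 ⟨φ F, hsupp, hψφ F⟩

theorem eq_zero_of_mem_hankelIdeal_of_totalDegree_le_one [CharZero k] (F : Form k n d)
    (hF : IsEssentialVariables (F : MvPolynomial (Fin (n + 1)) k) X)
    {Λ : Module.Dual k (MvPolynomial (Fin n) k)}
    (hΛ : Extends Λ (dualPolynomial (dehomogenize F))) {p : MvPolynomial (Fin n) k}
    (hpI : p ∈ hankelIdeal Λ) (hp : p.totalDegree ≤ 1) : p = 0 := by
  by_contra h0
  refine absurd (essNumber_le_of_directionalDeriv_eq_zero (fun ha => h0 ?_)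
    (directionalDeriv_eq_zero F hΛ hp hpI)) (by rw [← hF.2]; omega)
  rw [eq_of_totalDegree_le_one hp]
  have hc := congr_fun ha 0
  have hl := fun i : Fin n => congr_fun ha i.succ
  simp only [Fin.cons_zero, Fin.cons_succ, Pi.zero_apply] at hc hl
  simp [hc, hl]

end Derivative

/-! ### Minimal sums of evaluations -/

section Evaluations

variable {k : Type*} [Field k] {n d : ℕ}

theorem evalSum_apply {r : ℕ} (c : Fin r → k) (ζ : Fin r → Fin n → k)
    (p : MvPolynomial (Fin n) k) : evalSum c ζ p = ∑ i, c i * aeval (ζ i) p := by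
  simp [evalSum, LinearMap.sum_apply]

theorem mem_hankelIdeal_evalSum {r : ℕ} {c : Fin r → k} {ζ : Fin r → Fin n → k}
    {p : MvPolynomial (Fin n) k} (hp : ∀ i, aeval (ζ i) p = 0) :
    p ∈ hankelIdeal (evalSum c ζ) := by
  refine LinearMap.ext fun q => ?_
  change evalSum c ζ (p * q) = 0
  simp only [evalSum_apply, map_mul, hp, zero_mul, mul_zero, Finset.sum_const_zero]

/-- A relation `b` with `b j ≠ 0` could be subtracted, scaled by `c j / b j`, to remove the point `ζ
j` without changing the functional on degree at most `d`. -/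
theorem coefficients_eq_zero_of_minimal {φ : Module.Dual k (PolyLE k n d)} {r : ℕ}
    {c : Fin r → k} {ζ : Fin r → Fin n → k} (hext : Extends (evalSum c ζ) φ)
    (hmin : ∀ (s : ℕ) (b : Fin s → k) (ξ : Fin s → Fin n → k), Extends (evalSum b ξ) φ → r ≤ s)
    {b : Fin r → k} (hb : ∀ q ∈ PolyLE k n d, ∑ i, b i * aeval (ζ i) q = 0) : b = 0 := by
  by_contra h0
  obtain ⟨j, hj⟩ := Function.ne_iff.1 h0
  rw [Pi.zero_apply] at hj
  obtain _ | s := r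
  · exact j.elim0
  refine absurd (hmin s (fun i => c (j.succAbove i) - c j / b j * b (j.succAbove i))
    (fun i => ζ (j.succAbove i)) fun g => ?_) (by omega)
  have hg := hb g g.2
  rw [Fin.sum_univ_succAbove _ j] at hg
  rw [← hext g, evalSum_apply, evalSum_apply, Fin.sum_univ_succAbove _ j]
  simp only [sub_mul, mul_assoc, Finset.sum_sub_distrib, ← Finset.mul_sum]
  rw [eq_neg_of_add_eq_zero_right hg]
  field_simp
  ring

theorem exists_sub_mem_of_isMinimalEvalSum {φ : Module.Dual k (PolyLE k n d)}
    {Λ : Module.Dual k (MvPolynomial (Fin n) k)} (hΛ : Extends Λ φ)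
    (hmin : IsMinimalEvalSum Λ φ) (p : MvPolynomial (Fin n) k) :
    ∃ q ∈ PolyLE k n d, p - q ∈ hankelIdeal Λ := by
  obtain ⟨r, c, ζ, rfl, hmin⟩ := hmin
  let E : MvPolynomial (Fin n) k →ₗ[k] Fin r → k :=
    LinearMap.pi fun i => (aeval (ζ i) : MvPolynomial (Fin n) k →ₐ[k] k).toLinearMap
  -- A proper image would be killed by a nonzero functional on `k^r`, that is, by a relation among
  -- the evaluations on `R_{≤d}`.
  have htop : (PolyLE k n d).map E = ⊤ := by
    by_contra hne
    obtain ⟨f, hf0, hf⟩ := Submodule.exists_le_ker_of_lt_top _ (lt_top_iff_ne_top.2 hne)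
    have hfs : ∀ v, f v = ∑ i, f (Pi.single i 1) * v i := fun v => by
      rw [LinearMap.pi_apply_eq_sum_univ f v]
      refine Finset.sum_congr rfl fun i _ => ?_
      rw [smul_eq_mul, mul_comm]
      congr 2
      ext j
      simp [Pi.single_apply, eq_comm]
    have hb := coefficients_eq_zero_of_minimal hΛ hmin (b := fun i => f (Pi.single i 1))
      fun q hq => (hfs (E q)).symm.trans (hf ⟨q, hq, rfl⟩)
    refine hf0 (LinearMap.ext fun v => ?_)
    rw [hfs]
    exact Finset.sum_eq_zero fun i _ => by rw [congr_fun hb i, Pi.zero_apply, zero_mul]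
  obtain ⟨q, hq, hqp⟩ := htop.ge (Submodule.mem_top (x := E p))
  refine ⟨q, hq, mem_hankelIdeal_evalSum fun i => ?_⟩
  rw [map_sub, sub_eq_zero]
  exact (congr_fun hqp i).symm

end Evaluations

end WaringStaircase

theorem theorem3p8 {k : Type*} [Field k] [IsAlgClosed k] [CharZero k] {n d : ℕ}
    (F : WaringStaircase.Form k n d)
    (hF : WaringStaircase.IsEssentialVariables (F : MvPolynomial (Fin (n + 1)) k) MvPolynomial.X)
    (Λ : Module.Dual k (MvPolynomial (Fin n) k))
    (hΛ : WaringStaircase.Extends Λ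
      (WaringStaircase.dualPolynomial (WaringStaircase.dehomogenize F))) :
    ∃ B : Set (Fin n →₀ ℕ),
      WaringStaircase.IsMonomialBasis Λ B ∧
      WaringStaircase.IsCompleteStaircase B ∧
      0 ∈ B ∧
      (WaringStaircase.IsMinimalEvalSum Λ
          (WaringStaircase.dualPolynomial (WaringStaircase.dehomogenize F)) →
        ∀ α ∈ B, α.degree ≤ d) := by
  have hI := fun p hp hdeg =>
    WaringStaircase.eq_zero_of_mem_hankelIdeal_of_totalDegree_le_one (p := p) F hF hΛ hp hdeg
  exact ⟨WaringStaircase.standardExponents (WaringStaircase.hankelIdeal Λ),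
    WaringStaircase.isMonomialBasis_standardExponents Λ,
    ⟨WaringStaircase.isStaircase_standardExponents _,
      fun i => WaringStaircase.mem_standardExponents_of_degree_le hI (by simp)⟩,
    WaringStaircase.mem_standardExponents_of_degree_le hI (by simp),
    fun hmin α hα => WaringStaircase.degree_le_of_mem_standardExponents
      (WaringStaircase.exists_sub_mem_of_isMinimalEvalSum hΛ hmin) hα⟩
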